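/- Let $\omega_1$ be the first uncountable ordinal, i.e. the set of all countable ordinals, endowed with the order topology, and let $\mathrm{Homeo}(\omega_1)$ be its group of homeomorphisms, endowed with the topology of pointwise convergence (the topology induced by the product topology on $\omega_1^{\omega_1}$). Then $\mathrm{Homeo}(\omega_1)$ is a topological group, and it is amenable as a topological group. Here a topological group $H$ is called amenable if there is a left-invariant mean on the space $\mathcal{C}_{\mathrm{rucb}}(H)$ of all bounded right-uniformly continuous functions $f\colon H\to\mathbf{R}$, i.e. bounded functions such that for every $\varepsilon>0$ there is a neighbourhood $U$ of the identity with $|f(y)-f(x)|<\varepsilon$ whenever $yx^{-1}\in U$. A left-invariant mean is a linear functional $m\colon \mathcal{C}_{\mathrm{rucb}}(H)\to\mathbf{R}$ such that $m(f)\ge 0$ whenever $f\ge 0$, $m(1)=1$, and $m(f(g^{-1}\,\cdot\,))=m(f)$ for all $g\in H$ and all $f\in\mathcal{C}_{\mathrm{rucb}}(H)$. -/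

import Mathlib

open scoped Ordinal BoundedContinuousFunction

/-- The first uncountable ordinal `ω₁` as a space: the set of all countable ordinals. Its topology
is the order topology, see `orderTopology_omegaOne`. -/
abbrev OmegaOne : Type 1 := Set.Iio (ω₁ : Ordinal.{0})

theorem orderTopology_omegaOne : OrderTopology OmegaOne := inferInstance

/-- The topology of pointwise convergence on the homeomorphism group `X ≃ₜ X`: the topology induced
by the product topology on `X → X`, where `X` carries its own topology. -/
instance homeoPointwiseTopology (X : Type*) [TopologicalSpace X] : TopologicalSpace (X ≃ₜ X) :=
  TopologicalSpace.induced (fun g : X ≃ₜ X => (g : X → X)) inferInstance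

section Amenability

variable (G : Type*) [Group G] [TopologicalSpace G] [IsTopologicalGroup G]

/-- The space of bounded right-uniformly continuous real functions on a topological group, i.e.
those uniformly continuous for the right uniform structure, whose entourages are generated by the
sets `{(x, y) | y * x⁻¹ ∈ U}`, `U` a neighbourhood of the identity. -/
def Crucb : Submodule ℝ (G →ᵇ ℝ) where
  carrier := {f | @UniformContinuous G ℝ (IsTopologicalGroup.rightUniformSpace G) _ f}
  add_mem' {f h} hf hh := by
    let := IsTopologicalGroup.rightUniformSpace G
    exact UniformContinuous.add (f := f) (g := h) hf hh
  zero_mem' := by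
    let := IsTopologicalGroup.rightUniformSpace G
    exact uniformContinuous_const
  smul_mem' c f hf := by
    let := IsTopologicalGroup.rightUniformSpace G
    exact UniformContinuous.const_smul (f := f) hf c

variable {G}

theorem mem_Crucb_iff (f : G →ᵇ ℝ) :
    f ∈ Crucb G ↔
      ∀ ε > 0, ∃ U ∈ nhds (1 : G), ∀ x y : G, y * x⁻¹ ∈ U → |f y - f x| < ε := by
  let := IsTopologicalGroup.rightUniformSpace G
  change UniformContinuous f ↔ _
  have hb : (uniformity G).HasBasis (fun U : Set G => U ∈ nhds (1 : G))
      (fun U => {p : G × G | p.2 * p.1⁻¹ ∈ U}) :=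
    (nhds (1 : G)).basis_sets.comap (fun p : G × G => p.2 * p.1⁻¹)
  rw [hb.uniformContinuous_iff Metric.uniformity_basis_dist]
  simp only [Set.mem_ofPred_eq, Real.dist_eq]
  refine forall₂_congr fun ε _ => exists_congr fun U => and_congr_right fun _ =>
    forall₂_congr fun x y => ?_
  rw [abs_sub_comm]

/-- The left translate `x ↦ f (g⁻¹ * x)` of a bounded right-uniformly continuous function. -/
def Crucb.leftTranslate (g : G) (f : Crucb G) : Crucb G :=
  ⟨f.1.compContinuous ⟨fun x => g⁻¹ * x, continuous_const_mul g⁻¹⟩, by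
    rw [mem_Crucb_iff]
    intro ε hε
    obtain ⟨U, hU, h⟩ := (mem_Crucb_iff f.1).1 f.2 ε hε
    refine ⟨(fun u => g⁻¹ * u * g) ⁻¹' U, ?_, fun x y hxy => ?_⟩
    · have hc : Continuous fun u : G => g⁻¹ * u * g := by fun_prop
      exact hc.continuousAt.preimage_mem_nhds (by simpa using hU)
    · refine h (g⁻¹ * x) (g⁻¹ * y) ?_
      have e : g⁻¹ * y * (g⁻¹ * x)⁻¹ = g⁻¹ * (y * x⁻¹) * g := by group
      rw [e]
      exact hxy⟩

theorem Crucb.leftTranslate_apply (g : G) (f : Crucb G) (x : G) :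
    (Crucb.leftTranslate g f).1 x = f.1 (g⁻¹ * x) := rfl

variable (G)

/-- The constant function `1`. -/
def Crucb.one : Crucb G :=
  ⟨BoundedContinuousFunction.const G 1, by
    let := IsTopologicalGroup.rightUniformSpace G
    exact uniformContinuous_const⟩

/-- A topological group is amenable if there is a left-invariant mean, i.e. a left-invariant
positive normalized linear functional, on its bounded right-uniformly continuous functions. -/
def IsAmenableGroup : Prop :=
  ∃ m : Crucb G →ₗ[ℝ] ℝ,
    (∀ f : Crucb G, (∀ x, 0 ≤ f.1 x) → 0 ≤ m f) ∧
    m (Crucb.one G) = 1 ∧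
    ∀ (g : G) (f : Crucb G), m (Crucb.leftTranslate g f) = m f

end Amenability

/-! ### Permanence properties of invariant means -/

section InvariantMeans

variable {G : Type*} [Group G] [TopologicalSpace G] [IsTopologicalGroup G]

/-! Rank a point by the least element of its orbit under all homeomorphisms. Moving a point to that
least element `m` and using that `Set.Iic m` is open shows that all other nearby points have smaller
rank (`eventually_orbitMin_lt`). Since the rank is invariant, each evaluation `h ↦ h x` is locally
constant, which makes the group operations continuous.

Amenability goes by induction on the maximal rank in a compact clopen set `K`. The points of maximal
rank form a finite set `T`, permuted by the homeomorphisms supported in `K`; those supported in `K \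
T` form a subgroup of finite index. In that subgroup the compactly supported homeomorphisms are
dense, and they are a directed union of groups with smaller maximal rank. Invariant means pass to
directed unions by compactness, to closures by uniform continuity, and to finite-index overgroups by
averaging. The whole group is again the closure of such a directed union. -/

theorem Crucb.leftTranslate_mul (g h : G) (f : Crucb G) :
    leftTranslate (g * h) f = leftTranslate g (leftTranslate h f) := by
  ext x
  simp only [leftTranslate_apply, mul_inv_rev, mul_assoc]

theorem Crucb.leftTranslate_one (f : Crucb G) : leftTranslate 1 f = f := by
  ext x
  simp only [leftTranslate_apply, inv_one, one_mul]

theorem Crucb.leftTranslate_constOne (g : G) : leftTranslate g (one G) = one G := rfl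

theorem Crucb.leftTranslate_add (g : G) (f h : Crucb G) :
    leftTranslate g (f + h) = leftTranslate g f + leftTranslate g h := rfl

theorem Crucb.leftTranslate_smul (g : G) (c : ℝ) (f : Crucb G) :
    leftTranslate g (c • f) = c • leftTranslate g f := rfl

/-- The means on `Crucb G`, as plain functions, that are invariant under left translation by the
elements of the subgroup `H`. -/
def invariantMeans (H : Subgroup G) : Set (Crucb G → ℝ) :=
  {m | (∀ f h, m (f + h) = m f + m h) ∧ (∀ (c : ℝ) f, m (c • f) = c * m f) ∧
    (∀ f : Crucb G, (∀ x, 0 ≤ f.1 x) → 0 ≤ m f) ∧ m (Crucb.one G) = 1 ∧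
    ∀ g ∈ H, ∀ f, m (Crucb.leftTranslate g f) = m f}

theorem invariantMeans_anti {H N : Subgroup G} (h : N ≤ H) :
    invariantMeans H ⊆ invariantMeans N :=
  fun _ hm => ⟨hm.1, hm.2.1, hm.2.2.1, hm.2.2.2.1, fun g hg => hm.2.2.2.2 g (h hg)⟩

theorem invariantMeans_bot_nonempty : (invariantMeans (⊥ : Subgroup G)).Nonempty := by
  refine ⟨fun f => f.1 1, fun f h => rfl, fun c f => rfl, fun f hf => hf 1, rfl, ?_⟩
  rintro g hg f
  rw [Subgroup.mem_bot.1 hg, Crucb.leftTranslate_one]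

theorem isAmenableGroup_of_invariantMeans_top_nonempty
    (h : (invariantMeans (⊤ : Subgroup G)).Nonempty) : IsAmenableGroup G := by
  obtain ⟨m, hadd, hsmul, hpos, hone, hinv⟩ := h
  exact ⟨{ toFun := m, map_add' := hadd, map_smul' := hsmul }, hpos, hone,
    fun g f => hinv g (Subgroup.mem_top g) f⟩

theorem le_add_of_mem_invariantMeans {H : Subgroup G} {m : Crucb G → ℝ}
    (hm : m ∈ invariantMeans H) {f h : Crucb G} {c : ℝ} (hf : ∀ x, f.1 x ≤ h.1 x + c) :
    m f ≤ m h + c := by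
  obtain ⟨hadd, hsmul, hpos, hone, -⟩ := hm
  have key := hpos (h + c • Crucb.one G + (-1 : ℝ) • f) fun x => by
    have e : (h + c • Crucb.one G + (-1 : ℝ) • f).1 x = h.1 x + c * 1 + (-1) * f.1 x := rfl
    rw [e]
    linarith [hf x]
  rw [hadd, hadd, hsmul, hsmul, hone] at key
  linarith

theorem mem_Icc_norm_of_mem_invariantMeans {H : Subgroup G} {m : Crucb G → ℝ}
    (hm : m ∈ invariantMeans H) (f : Crucb G) : m f ∈ Set.Icc (-‖f.1‖) ‖f.1‖ := by
  have h0 : m 0 = 0 := by simpa using hm.2.1 0 0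
  have h1 : m f ≤ m 0 + ‖f.1‖ := le_add_of_mem_invariantMeans hm fun x => by
    have := (abs_le.1 (f.1.norm_coe_le_norm x)).2
    simpa using this
  have h2 : m 0 ≤ m f + ‖f.1‖ := le_add_of_mem_invariantMeans hm fun x => by
    have h := (abs_le.1 (f.1.norm_coe_le_norm x)).1
    have e : (0 : Crucb G).1 x = 0 := rfl
    rw [e]
    linarith
  constructor <;> linarith

theorem isClosed_invariantMeans (H : Subgroup G) : IsClosed (invariantMeans H) := by
  have hc : ∀ f : Crucb G, Continuous fun m : Crucb G → ℝ => m f := continuous_apply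
  simp only [invariantMeans, Set.ofPred_and, Set.ofPred_forall]
  refine IsClosed.inter ?_ (IsClosed.inter ?_ (IsClosed.inter ?_ (IsClosed.inter ?_ ?_)))
  · exact isClosed_iInter fun f => isClosed_iInter fun h =>
      isClosed_eq (hc _) ((hc _).add (hc _))
  · exact isClosed_iInter fun c => isClosed_iInter fun f =>
      isClosed_eq (hc _) (continuous_const.mul (hc _))
  · exact isClosed_iInter fun f => isClosed_iInter fun _ => isClosed_le continuous_const (hc _)
  · exact isClosed_eq (hc _) continuous_const
  · exact isClosed_iInter fun g => isClosed_iInter fun _ => isClosed_iInter fun f =>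
      isClosed_eq (hc _) (hc _)

theorem isCompact_invariantMeans (H : Subgroup G) : IsCompact (invariantMeans H) :=
  (isCompact_univ_pi fun f : Crucb G => isCompact_Icc (a := -‖f.1‖) (b := ‖f.1‖)).of_isClosed_subset
    (isClosed_invariantMeans H) fun _ hm f _ => mem_Icc_norm_of_mem_invariantMeans hm f

/-- The sets of means for the `H i` are compact and directed downwards, so they have a common point.
-/
theorem invariantMeans_iSup_nonempty {ι : Type*} [Nonempty ι] {H : ι → Subgroup G}
    (hd : Directed (· ≤ ·) H) (hH : ∀ i, (invariantMeans (H i)).Nonempty) :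
    (invariantMeans (⨆ i, H i)).Nonempty := by
  obtain ⟨m, hm⟩ := IsCompact.nonempty_iInter_of_directed_nonempty_isCompact_isClosed
    (fun i => invariantMeans (H i))
    (fun i j => (hd i j).imp fun k hk =>
      ⟨invariantMeans_anti hk.1, invariantMeans_anti hk.2⟩)
    hH (fun i => isCompact_invariantMeans _) (fun i => isClosed_invariantMeans _)
  rw [Set.mem_iInter] at hm
  obtain ⟨hadd, hsmul, hpos, hone, -⟩ := hm (Classical.arbitrary ι)
  refine ⟨m, hadd, hsmul, hpos, hone, fun g hg f => ?_⟩
  obtain ⟨i, hi⟩ := (Subgroup.mem_iSup_of_directed hd).1 hg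
  exact (hm i).2.2.2.2 g hi f

/-- Means on right-uniformly continuous functions have closed stabilizers. -/
theorem invariantMeans_subset_of_subset_closure {H N : Subgroup G}
    (h : (H : Set G) ⊆ closure (N : Set G)) : invariantMeans N ⊆ invariantMeans H := by
  intro m hm
  refine ⟨hm.1, hm.2.1, hm.2.2.1, hm.2.2.2.1, fun g hg f => ?_⟩
  refine eq_of_abs_sub_le_all fun ε hε => ?_
  obtain ⟨U, hU, hUf⟩ := (mem_Crucb_iff f.1).1 f.2 ε hε
  have hc : Continuous fun k : G => k⁻¹ * g := by fun_prop
  obtain ⟨k, hkU, hkN⟩ := mem_closure_iff_nhds.1 (h hg) _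
    (hc.continuousAt.preimage_mem_nhds (x := g) (by simpa using hU))
  -- `(k⁻¹ * x) * (g⁻¹ * x)⁻¹ = k⁻¹ * g` does not depend on `x`: right uniform continuity gives a
  -- bound uniform in `x`.
  have hk : ∀ x, |f.1 (k⁻¹ * x) - f.1 (g⁻¹ * x)| < ε := fun x =>
    hUf (g⁻¹ * x) (k⁻¹ * x) (by simpa [mul_assoc] using hkU)
  have h1 : m (Crucb.leftTranslate g f) ≤ m (Crucb.leftTranslate k f) + ε :=
    le_add_of_mem_invariantMeans hm fun x => by
      simp only [Crucb.leftTranslate_apply]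
      linarith [abs_lt.1 (hk x)]
  have h2 : m (Crucb.leftTranslate k f) ≤ m (Crucb.leftTranslate g f) + ε :=
    le_add_of_mem_invariantMeans hm fun x => by
      simp only [Crucb.leftTranslate_apply]
      linarith [abs_lt.1 (hk x)]
  rw [hm.2.2.2.2 k hkN] at h1 h2
  exact abs_le.2 ⟨by linarith, by linarith⟩

/-- An invariant mean for a subgroup of finite index can be averaged over the cosets. -/
theorem invariantMeans_nonempty_of_finite_quotient {H N : Subgroup G}
    [Finite (H ⧸ N.subgroupOf H)] (hN : (invariantMeans N).Nonempty) :
    (invariantMeans H).Nonempty := by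
  obtain ⟨m, hadd, hsmul, hpos, hone, hinv⟩ := hN
  have := Fintype.ofFinite (H ⧸ N.subgroupOf H)
  let r : H ⧸ N.subgroupOf H → G := fun q => (q.out : H)
  -- Inverses turn `h * n` into `n⁻¹ * h⁻¹`, whose outer translation by `n⁻¹` is absorbed by `m`; so
  -- the summand depends only on the left coset.
  have hr : ∀ (h : H) (f : Crucb G), m (Crucb.leftTranslate (r (h : H ⧸ N.subgroupOf H))⁻¹ f) =
      m (Crucb.leftTranslate (h : G)⁻¹ f) := by
    intro h f
    obtain ⟨n, hn⟩ := QuotientGroup.mk_out_eq_mul (N.subgroupOf H) h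
    have e : (r (h : H ⧸ N.subgroupOf H))⁻¹ = ((n : H) : G)⁻¹ * (h : G)⁻¹ := by
      simp only [r, hn, Subgroup.coe_mul, mul_inv_rev]
    rw [e, Crucb.leftTranslate_mul, hinv _ (N.inv_mem (Subgroup.mem_subgroupOf.1 n.2))]
  have hcard : (Fintype.card (H ⧸ N.subgroupOf H) : ℝ) ≠ 0 :=
    Nat.cast_ne_zero.2 Fintype.card_ne_zero
  refine ⟨fun f => (Fintype.card (H ⧸ N.subgroupOf H) : ℝ)⁻¹ *
    ∑ q, m (Crucb.leftTranslate (r q)⁻¹ f), ?_, ?_, ?_, ?_, ?_⟩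
  · intro f h
    simp only [Crucb.leftTranslate_add, hadd, Finset.sum_add_distrib, mul_add]
  · intro c f
    simp only [Crucb.leftTranslate_smul, hsmul, ← Finset.mul_sum]
    ring
  · intro f hf
    exact mul_nonneg (by positivity) (Finset.sum_nonneg fun q _ => hpos _ fun x => hf _)
  · simp only [Crucb.leftTranslate_constOne, hone, Finset.sum_const, Finset.card_univ,
      nsmul_eq_mul, mul_one]
    exact inv_mul_cancel₀ hcard
  · intro g hg f
    beta_reduce
    congr 1
    refine Fintype.sum_equiv (MulAction.toPerm (β := H ⧸ N.subgroupOf H) (⟨g, hg⟩⁻¹ : H)) _ _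
      fun q => ?_
    have e : MulAction.toPerm (⟨g, hg⟩⁻¹ : H) q =
        ((⟨g, hg⟩⁻¹ * q.out : H) : H ⧸ N.subgroupOf H) := by
      conv_lhs => rw [← QuotientGroup.out_eq' q]
      rfl
    rw [e, hr, ← Crucb.leftTranslate_mul]
    congr 2
    simp [r]

end InvariantMeans

/-! ### Supports of homeomorphisms and density of compact supports -/

section HomeoGroup

open Filter Topology

variable {X : Type*} [TopologicalSpace X]

theorem continuous_homeo_apply (x : X) : Continuous fun g : X ≃ₜ X => g x :=
  (continuous_apply x).comp continuous_induced_dom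

theorem mem_closure_of_eqOn_finite {D : Set (X ≃ₜ X)} {g : X ≃ₜ X}
    (h : ∀ F : Set X, F.Finite → ∃ d ∈ D, Set.EqOn d g F) : g ∈ closure D := by
  rw [mem_closure_iff_nhds]
  intro t ht
  rw [nhds_induced, mem_comap] at ht
  obtain ⟨s, hs, hst⟩ := ht
  rw [nhds_pi, mem_pi] at hs
  obtain ⟨F, hF, v, hv, hvs⟩ := hs
  obtain ⟨d, hd, hdg⟩ := h F hF
  exact ⟨d, hst (hvs fun x hx => by
    change d x ∈ v x
    rw [hdg hx]
    exact mem_of_mem_nhds (hv x)), hd⟩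

/-- The homeomorphism exchanging a clopen set with a disjoint homeomorphic image of it. -/
theorem exists_homeo_swap (h : X ≃ₜ X) {V : Set X} (hV : IsClopen V)
    (hd : ∀ x ∈ V, h x ∉ V) :
    ∃ s : X ≃ₜ X, (∀ x ∈ V, s x = h x) ∧ ∀ x, x ∉ V → h.symm x ∉ V → s x = x := by
  classical
  let f : X → X := V.piecewise h ((h.symm ⁻¹' V).piecewise h.symm id)
  have h1 : ∀ x ∈ V, f x = h x := fun x hx => Set.piecewise_eq_of_mem _ _ _ hx
  have h2 : ∀ x, x ∉ V → h.symm x ∈ V → f x = h.symm x := fun x hx hx' => by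
    simp only [f, Set.piecewise_eq_of_notMem _ _ _ hx]
    exact Set.piecewise_eq_of_mem _ _ _ hx'
  have h3 : ∀ x, x ∉ V → h.symm x ∉ V → f x = x := fun x hx hx' => by
    simp only [f, Set.piecewise_eq_of_notMem _ _ _ hx]
    exact Set.piecewise_eq_of_notMem _ _ _ hx'
  have hinv : Function.Involutive f := by
    intro x
    by_cases hx : x ∈ V
    · rw [h1 x hx, h2 _ (hd x hx) (by simpa using hx), h.symm_apply_apply]
    · by_cases hx' : h.symm x ∈ V
      · rw [h2 x hx hx', h1 _ hx', h.apply_symm_apply]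
      · rw [h3 x hx hx', h3 x hx hx']
  have hW : IsClopen (h.symm ⁻¹' V) := hV.preimage h.symm.continuous
  have hf : Continuous f := by
    refine Continuous.piecewise (by simp [hV.frontier_eq]) h.continuous ?_
    exact Continuous.piecewise (by simp [hW.frontier_eq]) h.symm.continuous continuous_id
  exact ⟨{ toEquiv := hinv.toPerm, continuous_toFun := hf, continuous_invFun := hf }, h1, h3⟩

/-- The homeomorphisms that are the identity outside `K`. -/
def homeoSupportedIn (K : Set X) : Subgroup (X ≃ₜ X) where
  carrier := {g | ∀ x ∉ K, g x = x}
  one_mem' _ _ := rfl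
  mul_mem' {g h} hg hh x hx := by rw [Homeomorph.mul_apply, hh x hx, hg x hx]
  inv_mem' {g} hg x hx := by
    rw [Homeomorph.inv_apply]
    exact g.symm_apply_eq.2 (hg x hx).symm

theorem homeoSupportedIn_mono {K L : Set X} (h : K ⊆ L) :
    homeoSupportedIn K ≤ homeoSupportedIn L :=
  fun _ hg x hx => hg x fun hxK => hx (h hxK)

theorem homeoSupportedIn_empty : homeoSupportedIn (∅ : Set X) = ⊥ :=
  (Subgroup.eq_bot_iff_forall _).2 fun _ hg => Homeomorph.ext fun x => hg x (Set.notMem_empty x)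

theorem apply_mem_of_mem_homeoSupportedIn {K : Set X} {g : X ≃ₜ X} (hg : g ∈ homeoSupportedIn K)
    {x : X} (hx : x ∈ K) : g x ∈ K := by
  by_contra h
  exact h (by rwa [g.injective (hg _ h)])

/-- The homeomorphisms supported in some compact clopen subset of `W`. -/
def homeoCompactlySupportedIn (W : Set X) : Subgroup (X ≃ₜ X) :=
  ⨆ K : {K : Set X // IsCompact K ∧ IsClopen K ∧ K ⊆ W}, homeoSupportedIn K.1

theorem directed_homeoSupportedIn (W : Set X) :
    Directed (· ≤ ·) fun K : {K : Set X // IsCompact K ∧ IsClopen K ∧ K ⊆ W} =>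
      homeoSupportedIn K.1 := fun K L =>
  ⟨⟨K.1 ∪ L.1, K.2.1.union L.2.1, K.2.2.1.union L.2.2.1, Set.union_subset K.2.2.2 L.2.2.2⟩,
    homeoSupportedIn_mono Set.subset_union_left, homeoSupportedIn_mono Set.subset_union_right⟩

instance (W : Set X) : Nonempty {K : Set X // IsCompact K ∧ IsClopen K ∧ K ⊆ W} :=
  ⟨⟨∅, isCompact_empty, isClopen_empty, Set.empty_subset W⟩⟩

theorem homeoSupportedIn_le_homeoCompactlySupportedIn {K W : Set X} (hK : IsCompact K)
    (hK' : IsClopen K) (h : K ⊆ W) : homeoSupportedIn K ≤ homeoCompactlySupportedIn W :=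
  le_iSup (fun K : {K : Set X // IsCompact K ∧ IsClopen K ∧ K ⊆ W} => homeoSupportedIn K.1)
    ⟨K, hK, hK', h⟩

theorem homeoCompactlySupportedIn_le (W : Set X) :
    homeoCompactlySupportedIn W ≤ homeoSupportedIn W :=
  iSup_le fun K => homeoSupportedIn_mono K.2.2.2

variable [T2Space X]

/-- Values are corrected one point at a time: if `d` is right on `F` but not at `x`, compose it with
the swap of a small clopen neighbourhood of `d x` and its image under `g * d⁻¹`. -/
theorem exists_homeoCompactlySupportedIn_eqOn
    (hX : ∀ x : X, ∀ U ∈ 𝓝 x, ∃ V, IsCompact V ∧ IsClopen V ∧ x ∈ V ∧ V ⊆ U)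
    {W : Set X} (hW : IsOpen W) {g : X ≃ₜ X} (hg : g ∈ homeoSupportedIn W)
    {F : Set X} (hF : F.Finite) :
    ∃ d ∈ homeoCompactlySupportedIn W, Set.EqOn d g F := by
  induction F, hF using Set.Finite.induction_on with
  | empty => exact ⟨1, one_mem _, Set.eqOn_empty _ _⟩
  | @insert x F hxF hF ih =>
    obtain ⟨d, hd, hdg⟩ := ih
    have hdW := homeoCompactlySupportedIn_le W hd
    by_cases hxW : x ∉ W
    · refine ⟨d, hd, fun y hy => ?_⟩
      rcases Set.mem_insert_iff.1 hy with rfl | hy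
      · rw [hdW _ hxW, hg _ hxW]
      · exact hdg hy
    rw [not_not] at hxW
    by_cases hne : d x = g x
    · refine ⟨d, hd, fun y hy => ?_⟩
      rcases Set.mem_insert_iff.1 hy with rfl | hy
      · exact hne
      · exact hdg hy
    let h : X ≃ₜ X := g * d⁻¹
    have hh : ∀ y, h (d y) = g y := fun y => by
      simp [h, Homeomorph.mul_apply, Homeomorph.inv_apply]
    obtain ⟨A, B, hA, hB, hxA, hxB, hAB⟩ := t2_separation hne
    have hC : IsClosed (g '' F) := (hF.image g).isClosed
    have hdF : d x ∉ g '' F := by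
      rintro ⟨y, hy, e⟩
      rw [← hdg hy] at e
      exact hxF (d.injective e ▸ hy)
    have hgF : g x ∉ g '' F := by
      rintro ⟨y, hy, e⟩
      exact hxF (g.injective e ▸ hy)
    -- `A` and `B` make the swapped sets disjoint, `W` controls the support, and avoiding `g '' F`
    -- preserves the values already correct.
    have hU : (A ∩ W ∩ (g '' F)ᶜ) ∩ h ⁻¹' (B ∩ W ∩ (g '' F)ᶜ) ∈ 𝓝 (d x) := by
      refine IsOpen.mem_nhds (((hA.inter hW).inter hC.isOpen_compl).inter
        (((hB.inter hW).inter hC.isOpen_compl).preimage h.continuous)) ?_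
      refine ⟨⟨⟨hxA, apply_mem_of_mem_homeoSupportedIn hdW hxW⟩, hdF⟩, ?_⟩
      rw [Set.mem_preimage, hh]
      exact ⟨⟨hxB, apply_mem_of_mem_homeoSupportedIn hg hxW⟩, hgF⟩
    obtain ⟨V, hVc, hVo, hxV, hVU⟩ := hX _ _ hU
    obtain ⟨s, hs1, hs2⟩ := exists_homeo_swap h hVo fun y hy hy' =>
      Set.disjoint_left.1 hAB (hVU hy').1.1.1 (hVU hy).2.1.1
    have hs : s ∈ homeoCompactlySupportedIn W := by
      have hcl : IsClopen (h '' V) :=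
        ⟨h.isClosedMap _ hVo.1, h.isOpenMap _ hVo.2⟩
      refine homeoSupportedIn_le_homeoCompactlySupportedIn
        (hVc.union (hVc.image h.continuous)) (hVo.union hcl) ?_ ?_
      · rintro y (hy | ⟨z, hz, rfl⟩)
        · exact (hVU hy).1.1.2
        · exact (hVU hz).2.1.2
      · intro y hy
        refine hs2 y (fun hy' => hy (Or.inl hy')) fun hy' => hy (Or.inr ⟨_, hy', ?_⟩)
        exact h.apply_symm_apply y
    refine ⟨s * d, mul_mem hs hd, fun y hy => ?_⟩
    rw [Homeomorph.mul_apply]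
    rcases Set.mem_insert_iff.1 hy with rfl | hy
    · rw [hs1 _ hxV, hh]
    · rw [hdg hy]
      have hgy : g y ∈ g '' F := ⟨y, hy, rfl⟩
      refine hs2 _ (fun hy' => (hVU hy').1.2 hgy) fun hy' => (hVU hy').2.2 ?_
      rwa [h.apply_symm_apply]

theorem homeoSupportedIn_subset_closure
    (hX : ∀ x : X, ∀ U ∈ 𝓝 x, ∃ V, IsCompact V ∧ IsClopen V ∧ x ∈ V ∧ V ⊆ U)
    {W : Set X} (hW : IsOpen W) :
    (homeoSupportedIn W : Set (X ≃ₜ X)) ⊆ closure (homeoCompactlySupportedIn W) :=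
  fun _ hg => mem_closure_of_eqOn_finite fun _ hF =>
    exists_homeoCompactlySupportedIn_eqOn hX hW hg hF

end HomeoGroup

/-! ### Spaces with an invariant rank -/

section Rank

open Filter Topology

variable {X : Type*} [TopologicalSpace X] {ι : Type*} [LinearOrder ι] {ρ : X → ι}

/-- `h x` and `g x` both have the rank of `x`, and `g x` is isolated among points of that rank. -/
theorem eventually_homeo_apply_eq (hinv : ∀ (g : X ≃ₜ X) x, ρ (g x) = ρ x)
    (hρ : ∀ x, ∀ᶠ y in 𝓝 x, y ≠ x → ρ y < ρ x) (g : X ≃ₜ X) (x : X) :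
    ∀ᶠ h : X ≃ₜ X in 𝓝 g, h x = g x := by
  filter_upwards [(continuous_homeo_apply x).continuousAt.eventually (hρ (g x))] with h hh
  by_contra hne
  have := hh hne
  rw [hinv, hinv] at this
  exact lt_irrefl _ this

/-- If a rank invariant under homeomorphisms isolates every point among the points of the same
rank, then the topology of pointwise convergence is a group topology. -/
theorem isTopologicalGroup_homeo (hinv : ∀ (g : X ≃ₜ X) x, ρ (g x) = ρ x)
    (hρ : ∀ x, ∀ᶠ y in 𝓝 x, y ≠ x → ρ y < ρ x) : IsTopologicalGroup (X ≃ₜ X) where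
  continuous_mul := by
    refine continuous_induced_rng.2 (continuous_pi fun x => continuous_iff_continuousAt.2 ?_)
    rintro ⟨g, h⟩
    refine tendsto_nhds_of_eventually_eq ?_
    rw [nhds_prod_eq]
    filter_upwards [(eventually_homeo_apply_eq hinv hρ g (h x)).prod_mk
      (eventually_homeo_apply_eq hinv hρ h x)] with p hp
    change p.1 (p.2 x) = g (h x)
    rw [hp.2, hp.1]
  continuous_inv := by
    refine continuous_induced_rng.2 (continuous_pi fun x => continuous_iff_continuousAt.2 ?_)
    intro g
    refine tendsto_nhds_of_eventually_eq ?_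
    filter_upwards [eventually_homeo_apply_eq hinv hρ g (g.symm x)] with h hh
    change h.symm x = g.symm x
    rw [h.symm_apply_eq, hh, g.apply_symm_apply]

/-- On a nonempty compact set the rank attains its maximum, at finitely many points only. -/
theorem exists_max_rank_finite (hρ : ∀ x, ∀ᶠ y in 𝓝 x, y ≠ x → ρ y < ρ x) {K : Set X}
    (hK : IsCompact K) (hne : K.Nonempty) :
    ∃ a ∈ K, (∀ x ∈ K, ρ x ≤ ρ a) ∧ {x ∈ K | ρ x = ρ a}.Finite := by
  obtain ⟨t, htK, ht⟩ := hK.elim_nhds_subcover (fun x => {y | y ≠ x → ρ y < ρ x})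
    fun x _ => hρ x
  have hcov : ∀ x ∈ K, ∃ y ∈ t, x ≠ y → ρ x < ρ y := fun x hx => by
    simpa using ht hx
  have htne : t.Nonempty := by
    obtain ⟨x, hx⟩ := hne
    obtain ⟨y, hy, -⟩ := hcov x hx
    exact ⟨y, hy⟩
  obtain ⟨a, hat, ha⟩ := t.exists_max_image ρ htne
  refine ⟨a, htK a hat, fun x hx => ?_, t.finite_toSet.subset fun x hx => ?_⟩
  · obtain ⟨y, hy, hxy⟩ := hcov x hx
    by_cases e : x = y
    · exact e ▸ ha y hy
    · exact (hxy e).le.trans (ha y hy)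
  · obtain ⟨y, hy, hxy⟩ := hcov x hx.1
    by_cases e : x = y
    · exact e ▸ hy
    · exact absurd ((hxy e).trans_le (ha y hy)) (by rw [hx.2]; exact lt_irrefl _)

variable [T2Space X] [WellFoundedLT ι] [IsTopologicalGroup (X ≃ₜ X)]

theorem invariantMeans_homeoSupportedIn_nonempty_of_compactlySupported
    (hX : ∀ x : X, ∀ U ∈ 𝓝 x, ∃ V, IsCompact V ∧ IsClopen V ∧ x ∈ V ∧ V ⊆ U)
    {W : Set X} (hW : IsOpen W)
    (h : ∀ K, IsCompact K → IsClopen K → K ⊆ W → (invariantMeans (homeoSupportedIn K)).Nonempty) :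
    (invariantMeans (homeoSupportedIn W)).Nonempty :=
  (invariantMeans_iSup_nonempty (directed_homeoSupportedIn W) fun K =>
    h K.1 K.2.1 K.2.2.1 K.2.2.2).mono
      (invariantMeans_subset_of_subset_closure (homeoSupportedIn_subset_closure hX hW))

theorem invariantMeans_homeoSupportedIn_nonempty
    (hX : ∀ x : X, ∀ U ∈ 𝓝 x, ∃ V, IsCompact V ∧ IsClopen V ∧ x ∈ V ∧ V ⊆ U)
    (hinv : ∀ (g : X ≃ₜ X) x, ρ (g x) = ρ x)
    (hρ : ∀ x, ∀ᶠ y in 𝓝 x, y ≠ x → ρ y < ρ x) (c : ι) :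
    ∀ K : Set X, IsCompact K → IsClopen K → (∀ x ∈ K, ρ x ≤ c) →
      (invariantMeans (homeoSupportedIn K)).Nonempty := by
  induction c using WellFoundedLT.induction with
  | ind c ih =>
  intro K hK hKo hKc
  rcases K.eq_empty_or_nonempty with rfl | hne
  · rw [homeoSupportedIn_empty]
    exact invariantMeans_bot_nonempty
  obtain ⟨a, haK, hmax, hfin⟩ := exists_max_rank_finite hρ hK hne
  set T := {x ∈ K | ρ x = ρ a}
  have hN : (invariantMeans (homeoSupportedIn (K \ T))).Nonempty := by
    refine invariantMeans_homeoSupportedIn_nonempty_of_compactlySupported hX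
      (hKo.2.sdiff hfin.isClosed) fun L hL hLo hLK => ?_
    have hlt : ∀ x ∈ L, ρ x < ρ a := fun x hx =>
      (hmax x (hLK hx).1).lt_of_ne fun e => (hLK hx).2 ⟨(hLK hx).1, e⟩
    rcases L.eq_empty_or_nonempty with rfl | hLne
    · rw [homeoSupportedIn_empty]
      exact invariantMeans_bot_nonempty
    -- Because the maximum on `L` is attained, it is strictly below `ρ a`.
    obtain ⟨b, hbL, hb, -⟩ := exists_max_rank_finite hρ hL hLne
    exact ih (ρ b) ((hlt b hbL).trans_le (hKc a haK)) L hL hLo hb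
  have : Finite T := hfin
  have hTmem : ∀ g ∈ homeoSupportedIn K, ∀ x ∈ T, g x ∈ T := fun g hg x hx =>
    ⟨apply_mem_of_mem_homeoSupportedIn hg hx.1, by rw [hinv, hx.2]⟩
  -- A coset is determined by the action of its representative on `T`.
  have hfq : Finite (homeoSupportedIn K ⧸ (homeoSupportedIn (K \ T)).subgroupOf
      (homeoSupportedIn K)) := by
    refine Finite.of_injective (β := T → T)
      (fun q x => ⟨(q.out : homeoSupportedIn K).1 x.1, hTmem _ q.out.2 x.1 x.2⟩) ?_
    intro p q hpq
    rw [← QuotientGroup.out_eq' p, ← QuotientGroup.out_eq' q, QuotientGroup.eq]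
    rw [Subgroup.mem_subgroupOf]
    intro x hx
    change (p.out : homeoSupportedIn K).1.symm ((q.out : homeoSupportedIn K).1 x) = x
    rw [Homeomorph.symm_apply_eq]
    by_cases hxT : x ∈ T
    · exact (congrArg Subtype.val (congrFun hpq ⟨x, hxT⟩)).symm
    · have hxK : x ∉ K := fun h => hx ⟨h, hxT⟩
      rw [p.out.2 x hxK, q.out.2 x hxK]
  exact invariantMeans_nonempty_of_finite_quotient hN

/-- Amenability of the homeomorphism group of a locally compact zero-dimensional space with a
well-ordered invariant rank that is locally strictly maximal at every point. -/
theorem isAmenableGroup_homeo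
    (hX : ∀ x : X, ∀ U ∈ 𝓝 x, ∃ V, IsCompact V ∧ IsClopen V ∧ x ∈ V ∧ V ⊆ U)
    (hinv : ∀ (g : X ≃ₜ X) x, ρ (g x) = ρ x)
    (hρ : ∀ x, ∀ᶠ y in 𝓝 x, y ≠ x → ρ y < ρ x) : IsAmenableGroup (X ≃ₜ X) := by
  refine isAmenableGroup_of_invariantMeans_top_nonempty ?_
  have h : (⊤ : Subgroup (X ≃ₜ X)) ≤ homeoSupportedIn Set.univ :=
    fun g _ x hx => absurd (Set.mem_univ x) hx
  refine Set.Nonempty.mono (invariantMeans_anti h) ?_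
  refine invariantMeans_homeoSupportedIn_nonempty_of_compactlySupported hX isOpen_univ
    fun K hK hKo _ => ?_
  rcases K.eq_empty_or_nonempty with rfl | hne
  · rw [homeoSupportedIn_empty]
    exact invariantMeans_bot_nonempty
  obtain ⟨a, -, ha, -⟩ := exists_max_rank_finite hρ hK hne
  exact invariantMeans_homeoSupportedIn_nonempty hX hinv hρ (ρ a) K hK hKo ha

end Rank

/-! ### Compact clopen neighbourhoods in successor orders -/

section SuccOrder

open Filter Topology

variable {X : Type*} [TopologicalSpace X] [LinearOrder X] [OrderTopology X] [SuccOrder X]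

theorem isOpen_Iic_of_succOrder (x : X) : IsOpen (Set.Iic x) := by
  by_cases hx : IsMax x
  · rw [hx.isTop.Iic_eq]
    exact isOpen_univ
  · rw [← Order.Iio_succ_of_not_isMax hx]
    exact isOpen_Iio

theorem exists_isCompact_isClopen_subset (hc : ∀ x : X, IsCompact (Set.Iic x)) (x : X)
    (U : Set X) (hU : U ∈ 𝓝 x) : ∃ V, IsCompact V ∧ IsClopen V ∧ x ∈ V ∧ V ⊆ U := by
  have hcl : IsClopen (Set.Iic x) := ⟨isClosed_Iic, isOpen_Iic_of_succOrder x⟩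
  by_cases h : ∃ l, l < x
  · obtain ⟨l, hl, hlU⟩ := exists_Ioc_subset_of_mem_nhds hU h
    have e : Set.Ioc l x = Set.Iic x \ Set.Iic l := by
      ext y
      simp [and_comm]
    have hV : IsClopen (Set.Ioc l x) := by
      rw [e]
      exact hcl.diff ⟨isClosed_Iic, isOpen_Iic_of_succOrder l⟩
    exact ⟨Set.Ioc l x, (hc x).of_isClosed_subset hV.1 Set.Ioc_subset_Iic_self, hV,
      Set.right_mem_Ioc.2 hl, hlU⟩
  · push Not at h
    refine ⟨Set.Iic x, hc x, hcl, Set.self_mem_Iic, fun y hy => ?_⟩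
    rw [le_antisymm hy (h y)]
    exact mem_of_mem_nhds hU

end SuccOrder

/-! ### The orbit rank on a well-order -/

section WellOrder

open Filter Topology

variable {X : Type*} [TopologicalSpace X] [LinearOrder X] [WellFoundedLT X]

/-- The least element of the orbit of `x` under all homeomorphisms. -/
noncomputable def orbitMin (x : X) : X :=
  WellFounded.min (wellFounded_lt (α := X)) (Set.range fun g : X ≃ₜ X => g x) ⟨x, 1, rfl⟩

theorem exists_homeo_apply_eq_orbitMin (x : X) : ∃ g : X ≃ₜ X, g x = orbitMin x :=
  WellFounded.min_mem (wellFounded_lt (α := X)) (Set.range fun g : X ≃ₜ X => g x) _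

theorem orbitMin_le (g : X ≃ₜ X) (x : X) : orbitMin x ≤ g x :=
  not_lt.1 (WellFounded.not_lt_min (wellFounded_lt (α := X)) (Set.range fun g : X ≃ₜ X => g x)
    ⟨g, rfl⟩)

theorem orbitMin_homeo_apply (g : X ≃ₜ X) (x : X) : orbitMin (g x) = orbitMin x := by
  apply le_antisymm
  · obtain ⟨h, hh⟩ := exists_homeo_apply_eq_orbitMin x
    rw [← hh]
    simpa [Homeomorph.mul_apply, Homeomorph.inv_apply] using orbitMin_le (h * g⁻¹) (g x)
  · obtain ⟨h, hh⟩ := exists_homeo_apply_eq_orbitMin (g x)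
    rw [← hh]
    exact orbitMin_le (h * g) x

variable [OrderTopology X] [SuccOrder X]

theorem eventually_orbitMin_lt (x : X) : ∀ᶠ y in 𝓝 x, y ≠ x → orbitMin y < orbitMin x := by
  obtain ⟨g, hg⟩ := exists_homeo_apply_eq_orbitMin x
  have hmem : Set.Iic (orbitMin x) ∈ 𝓝 (g x) :=
    (isOpen_Iic_of_succOrder _).mem_nhds hg.le
  filter_upwards [g.continuous.continuousAt.preimage_mem_nhds hmem] with y hy hne
  refine (orbitMin_le g y).trans_lt (lt_of_le_of_ne hy fun e => hne ?_)
  exact g.injective (e.trans hg.symm)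

end WellOrder

theorem isCompact_Iic_omegaOne (x : OmegaOne) : IsCompact (Set.Iic x) := by
  rw [Topology.IsInducing.subtypeVal.isCompact_iff]
  have e : Subtype.val '' Set.Iic x = Set.Icc (0 : Ordinal.{0}) x.1 := by
    ext y
    constructor
    · rintro ⟨z, hz, rfl⟩
      exact ⟨zero_le, hz⟩
    · rintro ⟨-, hy⟩
      exact ⟨⟨y, hy.trans_lt x.2⟩, hy, rfl⟩
  rw [e]
  exact isCompact_Icc

theorem mainTheorem1 :
    ∃ _ : IsTopologicalGroup (OmegaOne ≃ₜ OmegaOne), IsAmenableGroup (OmegaOne ≃ₜ OmegaOne) := by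
  have h := isTopologicalGroup_homeo (X := OmegaOne) orbitMin_homeo_apply eventually_orbitMin_lt
  exact ⟨h, isAmenableGroup_homeo (exists_isCompact_isClopen_subset isCompact_Iic_omegaOne)
    orbitMin_homeo_apply eventually_orbitMin_lt⟩
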